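/- Palindromes are of even length; a palindrome of length $2r$ has radius $r$, and $R(T)$ denotes the largest radius of a palindrome occurring as a contiguous fragment of the word $T$. A Monte Carlo streaming algorithm with $s$ bits of memory for words of length $n$ over a finite alphabet $\Sigma$ reads the letters $T[1],\dots,T[n]\in\Sigma$ one by one and keeps only $s$ bits between consecutive letters. The new contents of the memory are an arbitrary function of the old contents, the arriving letter, the number of letters read so far and the random choices, and after the last letter the algorithm outputs a real number $\ell$ determined by the contents of the memory and the random choices. It may depend arbitrarily on $n$, $E$ and $\Sigma$; neither the random choices nor the position counter are charged to the memory. It solves the longest palindrome problem with additive error $E$ with probability $1-\frac1n$ if, for every $T\in\Sigma^n$, $\ell\le R(T)\le \ell+E$ holds with probability at least $1-\frac1n$. **Theorem (Monte Carlo additive approximation).** There are absolute constants $c>0$ and $N$ such that for all $n\ge N$, every finite alphabet $\Sigma$ and every real $E$ with $1\le E\le 0.49\,n$, every Monte Carlo streaming algorithm that solves the longest palindrome problem on words of length $n$ over $\Sigma$ with additive error $E$ with probability $1-\frac1n$ uses at least $$c\cdot\frac nE\,\log_2\min\Big\{|\Sigma|,\frac nE\Big\}$$ bits of memory, that is, $\Omega\big(\frac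 nE\log\min\{|\Sigma|,\frac nE\}\big)$ bits. (For $|\Sigma|\le 1$ the bound is read as $0$.) -/

import Mathlib

/-! ### Palindromes

Only palindromes of even length are considered; a palindrome of length `2 * r` has radius `r`. -/

/-- The word `w` contains a fragment that is a palindrome of length `2 * r`, i.e. of radius `r`. -/
def HasPalindromeOfRadius {A : Type*} (w : List A) (r : ℕ) : Prop :=
  ∃ u : List A, u <:+: w ∧ u.length = 2 * r ∧ u.reverse = u

/-- The largest radius of a palindrome contained in `w`. -/
noncomputable def maxRadius {A : Type*} (w : List A) : ℕ :=
  sSup {r : ℕ | HasPalindromeOfRadius w r}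

theorem isGreatest_maxRadius {A : Type*} (w : List A) :
    IsGreatest {r : ℕ | HasPalindromeOfRadius w r} (maxRadius w) := by
  have hne : {r : ℕ | HasPalindromeOfRadius w r}.Nonempty :=
    ⟨0, [], List.nil_infix, by simp, by simp⟩
  have hb : BddAbove {r : ℕ | HasPalindromeOfRadius w r} := by
    refine ⟨w.length, ?_⟩
    rintro r ⟨u, hu, hl, -⟩
    have := hu.length_le
    omega
  exact ⟨Nat.sSup_mem hne hb, fun r hr => le_csSup hb hr⟩

/-! ### Streaming algorithms -/

/-- The contents of a memory of `s` bits. -/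
abbrev Memory (s : ℕ) : Type := Fin s → Bool

/-- A deterministic streaming algorithm over the alphabet `A` with `s` bits of memory.
Letters arrive one by one; between two letters only the `s` bits of memory are kept.
The new contents of the memory may depend arbitrarily on the number `h` of letters read before
(a free clock), on the old contents, and on the arriving letter. The answer is read off from
the contents of the memory after the last letter. -/
structure StreamingAlgorithm (A : Type*) (s : ℕ) where
  init : Memory s
  step : (h : ℕ) → Memory s → A → Memory s
  output : Memory s → ℝ

namespace StreamingAlgorithm

variable {A : Type*} {s : ℕ}

/-- The contents of the memory after reading the word, starting with contents `m`
when `h` letters have been read before. -/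
def run (D : StreamingAlgorithm A s) : (h : ℕ) → Memory s → List A → Memory s
  | _, m, [] => m
  | h, m, a :: w => D.run (h + 1) (D.step h m a) w

/-- The number reported after the whole word `w` has been read. -/
def answer (D : StreamingAlgorithm A s) (w : List A) : ℝ :=
  D.output (D.run 0 D.init w)

/-- On the word `w`, the reported number `ℓ` satisfies `ℓ ≤ R ≤ ℓ + E`, where `R` is the
largest radius of a palindrome in `w`. -/
def CorrectOn (D : StreamingAlgorithm A s) (E : ℝ) (w : List A) : Prop :=
  D.answer w ≤ maxRadius w ∧ (maxRadius w : ℝ) ≤ D.answer w + E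

end StreamingAlgorithm

/-- A Monte Carlo streaming algorithm with `s` bits of memory is a random deterministic streaming
algorithm with `s` bits of memory: `alg ω` is the algorithm that is run when the outcome of the
random choices is `ω`. It solves the longest palindrome problem on words of length `n` with
additive error `E` with probability `1 - 1 / n` if on each such word it errs with probability at
most `1 / n`. (For an event that is not measurable, `P.real` is the outer measure, so that the
condition says that the failure is contained in an event of probability at most `1 / n`.) -/
def SolvesLongestPalindrome {A Ω : Type*} {s : ℕ} [MeasurableSpace Ω]
    (P : MeasureTheory.Measure Ω) (alg : Ω → StreamingAlgorithm A s) (n : ℕ) (E : ℝ) : Prop :=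
  ∀ w : List A, w.length = n → P.real {ω | ¬ (alg ω).CorrectOn E w} ≤ 1 / (n : ℝ)

/-!
The memory of the algorithm after the first half of a word has to determine most of that half, for
many possible halves.

Fix letters `a ≠ b` and a block length `L > E`. A message `x` of `m` letters is stored in a word
whose first half, read backwards from the center, is `abab…` of length `g` followed by `L` copies of
each letter of `x`. The second half starts with the same `abab…`, repeats the blocks of
`x 0, …, x (k - 1)`, and then continues with a block of a letter `c`. The alternating part contains
no even palindrome and takes up at least about a quarter of the word, so a palindrome not centered
in the middle is not longer than the central one (`maxRadius_le_of_alternating`). Hence the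
largest radius is at least `g + (k + 1) * L` if `c = x k`, and at most `g + k * L` otherwise, and an
algorithm that is right about the queries for all `c` learns `x k` from `x 0, …, x (k - 1)` and the
memory (`StreamingAlgorithm.not_correctOn_query`).

An error probability of `1 / n` is too large for a union bound over all `m * q` queries about a
message over `q` letters, but the expected number of errors, at most `m * q / n`, is a small fraction
of `m` if `q ≤ √n`. The random choices can be fixed so that this holds on average over all
messages (`exists_sum_indicator_le`). A message is determined by the memory and by its letters at
the positions where some query goes wrong: knowing these, it is recovered letter by letter. Counting
messages with weight `(4 * q)⁻¹` for each such position (`sum_pow_card_bad_le`) and applying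
Jensen's inequality (`card_mul_exp_le_sum_inv_pow`) gives
`q ^ m * (4 * q) ^ (-(m * q / n)) ≤ 2 ^ s * (5 / 4) ^ m`, hence `s` is at least of order
`m * log q`. With `m` of order `n / E` and `q` the minimum of the size of the alphabet and
`√(n / E)`, this is the bound for large `n / E`; restricting `q` to `√(n / E)` costs only a constant
factor in the logarithm. For bounded `n / E` it suffices that the algorithm needs at least one bit,
since it has to distinguish `aaa…` from `abab…`.
-/

/-! ### Radii of palindromes -/

theorem HasPalindromeOfRadius.le_maxRadius {A : Type*} {w : List A} {r : ℕ}
    (h : HasPalindromeOfRadius w r) : r ≤ maxRadius w :=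
  (isGreatest_maxRadius w).2 h

/-- A word whose two halves, read outwards from some position, share the prefix `p` has a
palindrome of radius `p.length` around that position. -/
theorem hasPalindromeOfRadius_of_prefix {A : Type*} {p u v : List A} (hu : p <+: u)
    (hv : p <+: v) : HasPalindromeOfRadius (u.reverse ++ v) p.length := by
  obtain ⟨u, rfl⟩ := hu
  obtain ⟨v, rfl⟩ := hv
  exact ⟨p.reverse ++ p, ⟨u.reverse, v, by simp⟩, by simp; ring, by simp⟩

/-- A palindrome of radius `r`, described by its center `C`. -/
theorem HasPalindromeOfRadius.exists_center {A : Type*} {w : List A} {r : ℕ}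
    (h : HasPalindromeOfRadius w r) :
    ∃ C, r ≤ C ∧ C + r ≤ w.length ∧ ∀ i < r, w[C - 1 - i]? = w[C + i]? := by
  obtain ⟨u, ⟨s, e, rfl⟩, hl, hr⟩ := h
  refine ⟨s.length + r, by omega, by simp; omega, fun i hi => ?_⟩
  have key : u[r - 1 - i]? = u[r + i]? := by
    conv_lhs => rw [← hr]
    rw [List.getElem?_reverse (by omega)]
    congr 1
    omega
  have e1 : s.length + r - 1 - i - s.length = r - 1 - i := by omega
  have e2 : s.length + r + i - s.length = r + i := by omega
  rw [List.append_assoc, List.getElem?_append_right (i := s.length + r - 1 - i) (by omega),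
    List.getElem?_append_right (i := s.length + r + i) (by omega), e1, e2,
    List.getElem?_append_left (by omega), List.getElem?_append_left (by omega), key]

/-- The word `abab…` of length `g`. -/
def alternating {A : Type*} (a b : A) (g : ℕ) : List A :=
  (List.range g).map fun i => if i % 2 = 0 then a else b

@[simp]
theorem length_alternating {A : Type*} (a b : A) (g : ℕ) : (alternating a b g).length = g := by
  simp [alternating]

theorem getElem?_alternating_ne {A : Type*} {a b : A} (hab : a ≠ b) {g j : ℕ} (hj : j + 1 < g) :
    (alternating a b g)[j]? ≠ (alternating a b g)[j + 1]? := by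
  have h : j < g := by omega
  simp only [alternating, List.getElem?_map, List.getElem?_range, h, hj, Option.map_some, ne_eq,
    Option.some.injEq]
  rcases Nat.mod_two_eq_zero_or_one j with h0 | h0
  · have h1 : (j + 1) % 2 = 1 := by omega
    simp [h0, h1, hab]
  · have h1 : (j + 1) % 2 = 0 := by omega
    simp [h0, h1, hab.symm]

theorem maxRadius_alternating {A : Type*} {a b : A} (hab : a ≠ b) (g : ℕ) :
    maxRadius (alternating a b g) = 0 := by
  by_contra hne
  obtain ⟨C, hC, hC', h⟩ := (isGreatest_maxRadius (alternating a b g)).1.exists_center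
  rw [length_alternating] at hC'
  have h0 := h 0 (by omega)
  refine getElem?_alternating_ne hab (g := g) (j := C - 1) (by omega) ?_
  convert h0 using 2
  all_goals omega

/-- If the halves of a word, read outwards, start with a common alternating word of length `g`,
first differ after the common prefix `p`, and are not longer than `2 * g`, then the longest
palindrome is the central one: any other center lies between two distinct letters of the
alternating part or is too close to an end of the word. -/
theorem maxRadius_le_of_alternating {A : Type*} {a b c d : A} {p u v : List A} {g : ℕ}
    (hab : a ≠ b) (hcd : c ≠ d) (hp : alternating a b g <+: p)
    (hu : (p ++ c :: u).length ≤ 2 * g) (hv : (p ++ d :: v).length ≤ 2 * g) :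
    maxRadius ((p ++ c :: u).reverse ++ (p ++ d :: v)) ≤ p.length := by
  by_contra! hlt
  obtain ⟨C, hC, hC', h⟩ :=
    (isGreatest_maxRadius ((p ++ c :: u).reverse ++ (p ++ d :: v))).1.exists_center
  set r := maxRadius ((p ++ c :: u).reverse ++ (p ++ d :: v))
  have hgp : g ≤ p.length := by simpa using hp.length_le
  -- inside the alternating parts, adjacent letters differ
  have halt : ∀ q : List A, ∀ j, j + 1 < g → (p ++ q)[j]? ≠ (p ++ q)[j + 1]? := by
    intro q j hj
    obtain ⟨z, rfl⟩ := hp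
    have hne := getElem?_alternating_ne hab hj
    rwa [List.append_assoc, List.getElem?_append_left (by simp; omega),
      List.getElem?_append_left (by simp; omega)]
  have hru : (p ++ c :: u)[p.length]? = some c := by simp
  have hrv : (p ++ d :: v)[p.length]? = some d := by simp
  have hu0 : p.length < (p ++ c :: u).length := by simp
  have hv0 : p.length < (p ++ d :: v).length := by simp
  have hau := halt (c :: u)
  have hav := halt (d :: v)
  generalize p ++ c :: u = U at *
  generalize p ++ d :: v = V at *
  rw [List.length_append, List.length_reverse] at hC'
  rcases lt_trichotomy C U.length with hlt' | heq | hgt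
  · have h0 := h 0 (by omega)
    rw [List.getElem?_append_left (by simp; omega), List.getElem?_append_left (by simp; omega),
      List.getElem?_reverse (by omega), List.getElem?_reverse (by omega)] at h0
    refine hau (U.length - 1 - C) (by omega) ?_
    convert h0.symm using 2
    all_goals omega
  · have h0 := h p.length hlt
    rw [List.getElem?_append_left (by simp; omega), List.getElem?_append_right (by simp; omega),
      List.getElem?_reverse (by omega)] at h0
    have e1 : U.length - 1 - (C - 1 - p.length) = p.length := by omega
    have e2 : C + p.length - U.reverse.length = p.length := by simp; omega
    rw [e1, e2, hru, hrv] at h0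
    exact hcd (Option.some.inj h0)
  · have h0 := h 0 (by omega)
    rw [List.getElem?_append_right (by simp; omega),
      List.getElem?_append_right (by simp; omega)] at h0
    refine hav (C - 1 - U.length) (by omega) ?_
    convert h0 using 2
    all_goals simp only [List.length_reverse]; omega

/-! ### Words that reveal the contents of the memory -/

namespace StreamingAlgorithm

variable {A : Type*} {s : ℕ}

theorem run_append (D : StreamingAlgorithm A s) (h : ℕ) (m : Memory s) (w₁ w₂ : List A) :
    D.run h m (w₁ ++ w₂) = D.run (h + w₁.length) (D.run h m w₁) w₂ := by
  induction w₁ generalizing h m with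
  | nil => simp [run]
  | cons a w ih => simp [run, ih, Nat.add_assoc, Nat.add_comm 1]

/-- If the same answer is correct on two words, then their radii differ by at most `E`. -/
theorem CorrectOn.maxRadius_le_add {D : StreamingAlgorithm A s} {E : ℝ} {w w' : List A}
    (h : D.CorrectOn E w) (h' : D.CorrectOn E w') (he : D.answer w = D.answer w') :
    (maxRadius w : ℝ) ≤ maxRadius w' + E := by
  have h1 := h.2
  have h2 := h'.1
  linarith

end StreamingAlgorithm

/-- The word in which every letter of `l` is replaced by `L` copies of it. -/
def blowUp {A : Type*} (L : ℕ) (l : List A) : List A :=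
  l.flatMap (List.replicate L)

@[simp]
theorem length_blowUp {A : Type*} (L : ℕ) (l : List A) : (blowUp L l).length = l.length * L := by
  simp [blowUp]

@[simp]
theorem blowUp_nil {A : Type*} (L : ℕ) : blowUp L ([] : List A) = [] :=
  rfl

@[simp]
theorem blowUp_append {A : Type*} (L : ℕ) (l l' : List A) :
    blowUp L (l ++ l') = blowUp L l ++ blowUp L l' := by
  simp [blowUp]

@[simp]
theorem blowUp_cons {A : Type*} (L : ℕ) (x : A) (l : List A) :
    blowUp L (x :: l) = List.replicate L x ++ blowUp L l := by
  simp [blowUp]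

/-- The first half of the hard words, read backwards; it stores the message `l`. -/
def storedHalf {A : Type*} (a b : A) (g L : ℕ) (l : List A) : List A :=
  alternating a b g ++ blowUp L l

/-- The second half, of length `H`, of the hard words. It asks whether the message that has been
stored starts with `l ++ [c]`, given that it starts with `l`. -/
def queryHalf {A : Type*} (a b : A) (g L H : ℕ) (l : List A) (c : A) : List A :=
  alternating a b g ++ (blowUp L (l ++ [c]) ++ List.replicate (H - (g + (l.length + 1) * L)) a)

theorem length_storedHalf {A : Type*} (a b : A) (g L : ℕ) (l : List A) :
    (storedHalf a b g L l).length = g + l.length * L := by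
  simp [storedHalf]

theorem length_queryHalf {A : Type*} (a b : A) {g L H : ℕ} {l : List A} (c : A)
    (h : g + (l.length + 1) * L ≤ H) : (queryHalf a b g L H l c).length = H := by
  simp only [queryHalf, List.length_append, length_alternating, length_blowUp, List.length_cons,
    List.length_nil, List.length_replicate, Nat.zero_add]
  omega

theorem le_maxRadius_query {A : Type*} (a b : A) (g L H : ℕ) (l l' : List A) (c : A) :
    g + (l.length + 1) * L ≤
      maxRadius ((storedHalf a b g L (l ++ c :: l')).reverse ++ queryHalf a b g L H l c) := by
  have h := hasPalindromeOfRadius_of_prefix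
    (p := alternating a b g ++ blowUp L (l ++ [c]))
    (u := storedHalf a b g L (l ++ c :: l')) (v := queryHalf a b g L H l c)
    ⟨blowUp L l', by simp [storedHalf]⟩ ⟨_, by rw [queryHalf, List.append_assoc]⟩
  simpa [Nat.add_mul] using h.le_maxRadius

theorem maxRadius_query_le {A : Type*} {a b : A} (hab : a ≠ b) {g L H : ℕ} {l l' : List A}
    {c d : A} (hcd : d ≠ c) (hL : 0 < L) (hs : (l.length + (l'.length + 1)) * L ≤ g)
    (hH : H ≤ 2 * g) (hq : g + (l.length + 1) * L ≤ H) :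
    maxRadius ((storedHalf a b g L (l ++ d :: l')).reverse ++ queryHalf a b g L H l c) ≤
      g + l.length * L := by
  have hlen := length_queryHalf a b c hq
  have hlen' := length_storedHalf a b g L (l ++ d :: l')
  obtain ⟨L, rfl⟩ : ∃ K, L = K + 1 := ⟨L - 1, by omega⟩
  have e1 : storedHalf a b g (L + 1) (l ++ d :: l') =
      (alternating a b g ++ blowUp (L + 1) l) ++
        d :: (List.replicate L d ++ blowUp (L + 1) l') := by
    simp [storedHalf, List.replicate_succ]
  have e2 : queryHalf a b g (L + 1) H l c =
      (alternating a b g ++ blowUp (L + 1) l) ++ c :: (List.replicate L c ++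
        List.replicate (H - (g + (l.length + 1) * (L + 1))) a) := by
    simp [queryHalf, List.replicate_succ, blowUp]
  rw [e1] at hlen' ⊢
  rw [e2] at hlen ⊢
  have h := maxRadius_le_of_alternating hab hcd (List.prefix_append _ (blowUp (L + 1) l))
    (by rw [hlen']; simp only [List.length_append, List.length_cons]; omega)
    (hlen.trans_le hH)
  simpa using h

/-- Two messages that first differ after `l` and lead to the same contents of the memory cannot
both be handled correctly by the query for the letter that follows `l` in the first one. -/
theorem StreamingAlgorithm.not_correctOn_query {A : Type*} {s : ℕ} (D : StreamingAlgorithm A s)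
    {E : ℝ} {a b : A} (hab : a ≠ b) {g L H : ℕ} {l l₁ l₂ : List A} {c d : A} (hcd : d ≠ c)
    (hlen : l₁.length = l₂.length) (hL : 0 < L) (hE : E < L)
    (hs : (l.length + (l₂.length + 1)) * L ≤ g) (hH : H ≤ 2 * g)
    (hq : g + (l.length + 1) * L ≤ H)
    (hrun : D.run 0 D.init (storedHalf a b g L (l ++ c :: l₁)).reverse =
      D.run 0 D.init (storedHalf a b g L (l ++ d :: l₂)).reverse)
    (h₁ : D.CorrectOn E
      ((storedHalf a b g L (l ++ c :: l₁)).reverse ++ queryHalf a b g L H l c))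
    (h₂ : D.CorrectOn E
      ((storedHalf a b g L (l ++ d :: l₂)).reverse ++ queryHalf a b g L H l c)) : False := by
  have he : D.answer ((storedHalf a b g L (l ++ c :: l₁)).reverse ++ queryHalf a b g L H l c) =
      D.answer ((storedHalf a b g L (l ++ d :: l₂)).reverse ++ queryHalf a b g L H l c) := by
    simp [answer, run_append, hrun, length_storedHalf, hlen]
  have h := h₁.maxRadius_le_add h₂ he
  have k₁ : ((g + (l.length + 1) * L : ℕ) : ℝ) ≤ _ :=
    Nat.cast_le.2 (le_maxRadius_query a b g L H l l₁ c)
  have k₂ : _ ≤ ((g + l.length * L : ℕ) : ℝ) :=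
    Nat.cast_le.2 (maxRadius_query_le hab hcd hL hs hH hq (l' := l₂))
  push_cast at k₁ k₂
  linarith

/-! ### Counting messages -/

/-- Suppose that two messages with the same state can first differ only at a position that is bad
for one of them. A message is then determined by its state and its letters at the bad positions;
giving weight `t⁻¹` to every such letter bounds the weighted number of messages. -/
theorem sum_pow_card_bad_le {S B : Type*} [Fintype S] [Fintype B] {m : ℕ}
    (state : (Fin m → B) → S) (bad : (Fin m → B) → Fin m → Prop)
    [∀ x, DecidablePred (bad x)]
    (h : ∀ x y k, state x = state y → (∀ j < k, x j = y j) → x k ≠ y k → bad x k ∨ bad y k)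
    {t : ℝ} (ht : 0 < t) :
    ∑ x, t⁻¹ ^ (Finset.univ.filter (bad x)).card ≤
      Fintype.card S * (1 + Fintype.card B * t⁻¹) ^ m := by
  classical
  let code : (Fin m → B) → S × (Fin m → Option B) :=
    fun x => (state x, fun k => if bad x k then some (x k) else none)
  let wt : Option B → ℝ := fun o => o.elim 1 fun _ => t⁻¹
  have hwt : ∀ o, 0 ≤ wt o := by rintro (_ | _) <;> simp [wt, ht.le]
  have hinj : Function.Injective code := by
    intro x y hxy
    simp only [code, Prod.mk.injEq] at hxy
    have hstep : ∀ k, (∀ j < k, x j = y j) → x k = y k := by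
      intro k hk
      by_contra hne
      have hb := h x y k hxy.1 hk hne
      have hk' := congrFun hxy.2 k
      by_cases h1 : bad x k <;> by_cases h2 : bad y k <;> simp_all
    funext k
    induction k using WellFoundedLT.induction with
    | ind k ih => exact hstep k ih
  calc ∑ x, t⁻¹ ^ (Finset.univ.filter (bad x)).card
      = ∑ x, ∏ k, wt ((code x).2 k) := by
        refine Finset.sum_congr rfl fun x _ => ?_
        rw [← Finset.prod_const, Finset.prod_filter]
        refine Finset.prod_congr rfl fun k _ => ?_
        by_cases hb : bad x k <;> simp [code, wt, hb]
    _ = ∑ y ∈ Finset.univ.image code, ∏ k, wt (y.2 k) := by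
        rw [Finset.sum_image fun x _ y _ hxy => hinj hxy]
    _ ≤ ∑ y : S × (Fin m → Option B), ∏ k, wt (y.2 k) :=
        Finset.sum_le_sum_of_subset_of_nonneg (Finset.subset_univ _)
          fun y _ _ => Finset.prod_nonneg fun k _ => hwt _
    _ = Fintype.card S * (1 + Fintype.card B * t⁻¹) ^ m := by
        rw [Fintype.sum_prod_type]
        simp only [Finset.sum_const, Finset.card_univ, nsmul_eq_mul]
        rw [← Fintype.piFinset_univ, ← Finset.prod_univ_sum]
        simp [wt, Fintype.sum_option]

/-- Jensen's inequality for the function `x ↦ t⁻¹ ^ x`. -/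
theorem card_mul_exp_le_sum_inv_pow {ι : Type*} [Fintype ι] (f : ι → ℕ) {t b : ℝ} (ht : 1 ≤ t)
    (hb : ∑ i, (f i : ℝ) ≤ Fintype.card ι * b) :
    Fintype.card ι * Real.exp (-(b * Real.log t)) ≤ ∑ i, t⁻¹ ^ f i := by
  have hlog := Real.log_nonneg ht
  have hterm : ∀ i, Real.exp (-(b * Real.log t)) * (1 + (b - f i) * Real.log t) ≤ t⁻¹ ^ f i := by
    intro i
    have e : t⁻¹ ^ f i =
        Real.exp (-(b * Real.log t)) * Real.exp ((b - f i) * Real.log t) := by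
      rw [← Real.exp_add, ← Real.exp_log (inv_pos.2 (by linarith : 0 < t)), ← Real.exp_nat_mul,
        Real.log_inv]
      congr 1
      ring
    rw [e]
    gcongr
    linarith [Real.add_one_le_exp ((b - f i) * Real.log t)]
  refine le_trans ?_ (Finset.sum_le_sum fun i _ => hterm i)
  rw [← Finset.mul_sum, Finset.sum_add_distrib, ← Finset.sum_mul, Finset.sum_sub_distrib,
    mul_comm]
  gcongr
  simp only [Finset.sum_const, Finset.card_univ, nsmul_eq_mul, mul_one]
  nlinarith

/-! ### Fixing the random choices -/

open MeasureTheory in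
/-- If all events of a finite family have probability at most `δ`, then some outcome lies in at most
a fraction `δ` of them. The events need not be measurable: they are replaced by their measurable
hulls. -/
theorem exists_sum_indicator_le {Ω ι : Type*} [MeasurableSpace Ω] [Fintype ι] (P : Measure Ω)
    [IsProbabilityMeasure P] (F : ι → Set Ω) {δ : ℝ} (hF : ∀ i, P.real (F i) ≤ δ) :
    ∃ ω, ∑ i, (F i).indicator (1 : Ω → ℝ) ω ≤ Fintype.card ι * δ := by
  rcases isEmpty_or_nonempty ι with hι | ⟨⟨i₀⟩⟩
  · obtain ⟨ω⟩ := nonempty_of_isProbabilityMeasure P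
    exact ⟨ω, by simp⟩
  have hδ : 0 ≤ δ := measureReal_nonneg.trans (hF i₀)
  let f : Ω → ENNReal := fun ω => ∑ i, (toMeasurable P (F i)).indicator 1 ω
  have hmeas : ∀ i, Measurable ((toMeasurable P (F i)).indicator (1 : Ω → ENNReal)) :=
    fun i => measurable_one.indicator (measurableSet_toMeasurable P (F i))
  have hf : AEMeasurable f P := (Finset.measurable_sum _ fun i _ => hmeas i).aemeasurable
  obtain ⟨ω, hω⟩ := exists_le_lintegral hf
  have hint : ∫⁻ ω, f ω ∂P ≤ ENNReal.ofReal (Fintype.card ι * δ) := by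
    rw [lintegral_finsetSum _ fun i _ => hmeas i]
    simp only [lintegral_indicator_one (measurableSet_toMeasurable P _), measure_toMeasurable]
    calc ∑ i, P (F i) ≤ ∑ _i : ι, ENNReal.ofReal δ :=
          Finset.sum_le_sum fun i _ =>
            (ENNReal.le_ofReal_iff_toReal_le (measure_ne_top P _) hδ).2 (hF i)
      _ = ENNReal.ofReal (Fintype.card ι * δ) := by
          rw [ENNReal.ofReal_mul (by positivity)]
          simp
  have hsum : ENNReal.ofReal (∑ i, (F i).indicator (1 : Ω → ℝ) ω) ≤ f ω := by
    rw [ENNReal.ofReal_sum_of_nonneg fun i _ => Set.indicator_nonneg (by simp) ω]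
    refine Finset.sum_le_sum fun i _ => ?_
    by_cases hi : ω ∈ F i
    · simp [hi, subset_toMeasurable P (F i) hi]
    · simp [hi]
  exact ⟨ω, (ENNReal.ofReal_le_ofReal_iff (by positivity)).1 ((hsum.trans hω).trans hint)⟩

/-! ### The lower bound on the memory -/

/-- The message `x` over the letters `ι 0, …, ι (q - 1)` as a word. -/
def messageWord {A : Type*} {q m : ℕ} (ι : Fin q → A) (x : Fin m → Fin q) : List A :=
  List.ofFn fun i => ι (x i)

@[simp]
theorem length_messageWord {A : Type*} {q m : ℕ} (ι : Fin q → A) (x : Fin m → Fin q) :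
    (messageWord ι x).length = m := by
  simp [messageWord]

theorem messageWord_eq_append {A : Type*} {q m : ℕ} (ι : Fin q → A) (x : Fin m → Fin q)
    (k : Fin m) : messageWord ι x =
      (messageWord ι x).take k ++ ι (x k) :: (messageWord ι x).drop (k + 1) := by
  conv_lhs => rw [← List.take_append_drop k (messageWord ι x)]
  rw [List.drop_eq_getElem_cons (by simp)]
  simp [messageWord]

theorem take_messageWord_congr {A : Type*} {q m : ℕ} (ι : Fin q → A) {x y : Fin m → Fin q}
    {k : Fin m} (h : ∀ j < k, x j = y j) :
    (messageWord ι x).take k = (messageWord ι y).take k := by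
  refine List.ext_getElem (by simp) fun i h₁ _ => ?_
  have hi : i < k := by simp at h₁; omega
  simp [messageWord, h ⟨i, by omega⟩ (Fin.lt_def.2 hi)]

/-- The hard word of length `n` that stores the message `x` and asks whether the letter of `x` at
position `k` is `ι c`. -/
def hardWord {A : Type*} {q m : ℕ} (ι : Fin q → A) (a b : A) (g L n : ℕ) (x : Fin m → Fin q)
    (k : Fin m) (c : Fin q) : List A :=
  (storedHalf a b g L (messageWord ι x)).reverse ++
    queryHalf a b g L (n - n / 2) ((messageWord ι x).take k) (ι c)

theorem query_fits {g m L n k : ℕ} (hg : g + m * L = n / 2) (hk : k < m) :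
    g + (k + 1) * L ≤ n - n / 2 := by
  have : (k + 1) * L ≤ m * L := Nat.mul_le_mul_right _ hk
  omega

theorem length_hardWord {A : Type*} {q m : ℕ} (ι : Fin q → A) (a b : A) {g L n : ℕ}
    (hg : g + m * L = n / 2) (x : Fin m → Fin q) (k : Fin m) (c : Fin q) :
    (hardWord ι a b g L n x k c).length = n := by
  have hk := k.2
  rw [hardWord, List.length_append, List.length_reverse, length_storedHalf, length_messageWord,
    length_queryHalf, hg]
  · omega
  · rw [List.length_take, length_messageWord, min_eq_left hk.le]
    exact query_fits hg hk

/-- The bound on the memory in terms of the number `m` of letters in a message, the number `q` of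
letters to choose from, and the length `n` of the hard words. -/
theorem SolvesLongestPalindrome.mul_log_le {A Ω : Type*} [MeasurableSpace Ω]
    {P : MeasureTheory.Measure Ω} [MeasureTheory.IsProbabilityMeasure P] {s n : ℕ} {E : ℝ}
    {alg : Ω → StreamingAlgorithm A s} (hsol : SolvesLongestPalindrome P alg n E)
    {q m g L : ℕ} {ι : Fin q → A} (hι : Function.Injective ι) {a b : A} (hab : a ≠ b)
    (hq : 0 < q) (hL : 0 < L) (hEL : E < L) (hg : g + m * L = n / 2) (hmg : m * L < g) :
    m * Real.log q ≤ s * Real.log 2 + m * Real.log (5 / 4) + m * q / n * Real.log (4 * q) := by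
  classical
  have hq1 : (1 : ℝ) ≤ q := by exact_mod_cast hq
  -- fix the random choices
  obtain ⟨ω, hω⟩ := exists_sum_indicator_le P
    (fun i : (Fin m → Fin q) × Fin m × Fin q =>
      {ω | ¬ (alg ω).CorrectOn E (hardWord ι a b g L n i.1 i.2.1 i.2.2)})
    (fun i => hsol _ (length_hardWord ι a b hg _ _ _))
  set D := alg ω
  let fail : (Fin m → Fin q) → Fin m → Fin q → Prop :=
    fun x k c => ¬ D.CorrectOn E (hardWord ι a b g L n x k c)
  let bad : (Fin m → Fin q) → Fin m → Prop := fun x k => ∃ c, fail x k c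
  -- the number of bad positions is bounded by the number of errors
  have hbad : ∑ x, ((Finset.univ.filter (bad x)).card : ℝ) ≤
      Fintype.card (Fin m → Fin q) * (m * q / n) := by
    calc ∑ x, ((Finset.univ.filter (bad x)).card : ℝ)
        ≤ ∑ x, ∑ k, ∑ c, {ω | ¬ (alg ω).CorrectOn E (hardWord ι a b g L n x k c)}.indicator
            (1 : Ω → ℝ) ω := by
          refine Finset.sum_le_sum fun x _ => ?_
          rw [Finset.card_filter, Nat.cast_sum]
          refine Finset.sum_le_sum fun k _ => ?_
          have hnonneg : ∀ c ∈ Finset.univ, 0 ≤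
              {ω | ¬ (alg ω).CorrectOn E (hardWord ι a b g L n x k c)}.indicator
                (1 : Ω → ℝ) ω := fun c _ => Set.indicator_nonneg (by simp) ω
          split_ifs with hk
          · obtain ⟨c, hc⟩ := hk
            refine le_trans (le_of_eq ?_) (Finset.single_le_sum hnonneg (Finset.mem_univ c))
            rw [Set.indicator_of_mem hc]
            simp
          · simpa using Finset.sum_nonneg hnonneg
      _ ≤ _ := by simpa only [Fintype.sum_prod_type] using hω
      _ = _ := by
          simp only [Fintype.card_prod, Fintype.card_fin, Nat.cast_mul]
          ring
  have hdiff : ∀ x y k, D.run 0 D.init (storedHalf a b g L (messageWord ι x)).reverse =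
      D.run 0 D.init (storedHalf a b g L (messageWord ι y)).reverse →
      (∀ j < k, x j = y j) → x k ≠ y k → bad x k ∨ bad y k := by
    intro x y k hrun hjk hne
    by_contra! hgood
    have h₁ : D.CorrectOn E (hardWord ι a b g L n x k (x k)) :=
      not_not.1 fun h => hgood.1 ⟨_, h⟩
    have h₂ : D.CorrectOn E (hardWord ι a b g L n y k (x k)) :=
      not_not.1 fun h => hgood.2 ⟨_, h⟩
    have hk := k.2
    unfold hardWord at h₁ h₂
    have hlen : ((messageWord ι y).take k).length = k := by simp [hk.le]
    rw [take_messageWord_congr ι hjk] at h₁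
    have ex := messageWord_eq_append ι x k
    rw [take_messageWord_congr ι hjk] at ex
    have ey := messageWord_eq_append ι y k
    generalize hly : (messageWord ι y).take k = l at *
    rw [ex] at hrun h₁
    rw [ey] at hrun h₂
    refine D.not_correctOn_query hab (hι.ne hne.symm) (by simp) hL hEL ?_ (by omega)
      (by rw [hlen]; exact query_fits hg hk) hrun h₁ h₂
    have : l.length + (((messageWord ι y).drop (k + 1)).length + 1) = m := by
      rw [hlen, List.length_drop, length_messageWord]
      omega
    rw [this]
    exact hmg.le
  -- at weight `(4 * q)⁻¹`, each position has total weight `1 + q / (4 * q)`: it is good, or it is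
  -- bad and one of `q` letters is recorded for it
  have hsum := (card_mul_exp_le_sum_inv_pow _ (by linarith : (1 : ℝ) ≤ 4 * q) hbad).trans
    (sum_pow_card_bad_le _ bad hdiff (by linarith : (0 : ℝ) < 4 * q))
  have e : (1 + (Fintype.card (Fin q) : ℝ) * (4 * (q : ℝ))⁻¹) = 5 / 4 := by
    rw [Fintype.card_fin]
    field_simp
    norm_num
  rw [e] at hsum
  have hlog := Real.log_le_log (mul_pos (by simp; positivity) (Real.exp_pos _)) hsum
  rw [Real.log_mul (by simp; omega) (Real.exp_pos _).ne', Real.log_exp,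
    Real.log_mul (x := (Fintype.card (Memory s) : ℝ)) (by simp) (by positivity),
    Real.log_pow] at hlog
  simp only [Fintype.card_fun, Fintype.card_fin, Fintype.card_bool, Nat.cast_pow, Real.log_pow,
    Nat.cast_ofNat] at hlog
  linarith

/-- Without memory, the answers to `aaa…` and `abab…` coincide. -/
theorem SolvesLongestPalindrome.memory_pos {A Ω : Type*} [MeasurableSpace Ω]
    {P : MeasureTheory.Measure Ω} [MeasureTheory.IsProbabilityMeasure P] {s n : ℕ} {E : ℝ}
    {alg : Ω → StreamingAlgorithm A s} (hsol : SolvesLongestPalindrome P alg n E)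
    {a b : A} (hab : a ≠ b) (hn : 2 < n) (hE : E < (n / 2 : ℕ)) : 0 < s := by
  classical
  rw [Nat.pos_iff_ne_zero]
  rintro rfl
  let w : Bool → List A := fun i => if i then List.replicate n a else alternating a b n
  obtain ⟨ω, hω⟩ := exists_sum_indicator_le P (fun i => {ω | ¬ (alg ω).CorrectOn E (w i)})
    (fun i => hsol _ (by cases i <;> simp [w]))
  have hn' : (2 : ℝ) < n := by exact_mod_cast hn
  have hcor : ∀ i, (alg ω).CorrectOn E (w i) := by
    intro i
    by_contra hi
    have h1 := Finset.single_le_sum (f := fun i =>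
        {ω | ¬ (alg ω).CorrectOn E (w i)}.indicator (1 : Ω → ℝ) ω)
      (fun i _ => Set.indicator_nonneg (by simp) ω) (Finset.mem_univ i)
    have h2 : {ω | ¬ (alg ω).CorrectOn E (w i)}.indicator (1 : Ω → ℝ) ω = 1 :=
      Set.indicator_of_mem hi _
    have h3 : (Fintype.card Bool : ℝ) * (1 / n) < 1 := by
      rw [Fintype.card_bool, mul_one_div, div_lt_one (by linarith)]
      exact_mod_cast hn
    linarith
  have h := (hcor true).maxRadius_le_add (hcor false)
    (congrArg (alg ω).output (Subsingleton.elim _ _))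
  have h0 : maxRadius (w false) = 0 := by simp [w, maxRadius_alternating hab]
  have h1 : n / 2 ≤ maxRadius (w true) := by
    refine HasPalindromeOfRadius.le_maxRadius
      ⟨List.replicate (2 * (n / 2)) a, ⟨[], List.replicate (n - 2 * (n / 2)) a, ?_⟩, by simp,
        by simp⟩
    simp only [w, if_true, List.nil_append, List.replicate_append_replicate]
    congr 1
    omega
  have h1' : ((n / 2 : ℕ) : ℝ) ≤ maxRadius (w true) := by exact_mod_cast h1
  rw [h0, Nat.cast_zero] at h
  linarith

/-- The bound for `n / E ≥ 100`: messages of about `n / (8 * E)` letters, taken from a set of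
about `√(n / E)` letters or from the whole alphabet if it is smaller, fit into words of
length `n`. -/
theorem SolvesLongestPalindrome.mul_log_min_le {A Ω : Type*} [Fintype A] [MeasurableSpace Ω]
    {P : MeasureTheory.Measure Ω} [MeasureTheory.IsProbabilityMeasure P] {s n : ℕ} {E : ℝ}
    {alg : Ω → StreamingAlgorithm A s} (hsol : SolvesLongestPalindrome P alg n E)
    {a b : A} (hab : a ≠ b) (hn : 10000 ≤ n) (hE : 1 ≤ E) (hy : 100 ≤ n / E) :
    n / E * Real.log (min (Fintype.card A) (n / E)) ≤ 128 * (s * Real.log 2) := by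
  have hcard : 2 ≤ Fintype.card A := by
    have : Nontrivial A := ⟨a, b, hab⟩
    exact Fintype.one_lt_card
  have hnR : (10000 : ℝ) ≤ n := by exact_mod_cast hn
  set y : ℝ := n / E with hydef
  have hyn : y ≤ n := div_le_self (by linarith) hE
  have hyE : y * E = n := by rw [hydef]; field_simp
  -- the alphabet of the messages
  let q : ℕ := min (Fintype.card A) ⌊√y⌋₊
  have hsq : √y * √y = y := Real.mul_self_sqrt (by linarith)
  have hsqrt : 10 ≤ √y := Real.le_sqrt_of_sq_le (by linarith)
  have hq2 : 2 ≤ q := le_min hcard (Nat.le_floor (by push_cast; linarith))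
  have hq2R : (2 : ℝ) ≤ q := by exact_mod_cast hq2
  have hqs : (q : ℝ) ≤ √y :=
    (Nat.cast_le.2 (min_le_right _ _)).trans (Nat.floor_le (Real.sqrt_nonneg y))
  have hqz : min (Fintype.card A : ℝ) y ≤ (q : ℝ) ^ 4 := by
    rcases min_choice (Fintype.card A) ⌊√y⌋₊ with h | h
    · have hqc : (q : ℝ) = Fintype.card A := by exact_mod_cast h
      refine (min_le_left _ _).trans ?_
      rw [← hqc]
      exact le_self_pow₀ (by linarith) (by norm_num)
    · have hqc : q = ⌊√y⌋₊ := h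
      have hlt : √y < q + 1 := by rw [hqc]; exact Nat.lt_floor_add_one _
      refine (min_le_right _ _).trans ?_
      have h1 : (q : ℝ) + 1 ≤ q ^ 2 := by nlinarith
      calc y = √y * √y := hsq.symm
        _ ≤ (q ^ 2) * (q ^ 2) := by gcongr <;> linarith
        _ = (q : ℝ) ^ 4 := by ring
  obtain ⟨ι⟩ : Nonempty (Fin q ↪ A) :=
    Function.Embedding.nonempty_of_card_le (by simp [q])
  -- the length of a block and the number of blocks
  let L : ℕ := ⌊E⌋₊ + 1
  have hEL : E < L := by simpa [L] using Nat.lt_floor_add_one E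
  have hL2 : (L : ℝ) ≤ 2 * E := by
    have := Nat.floor_le (by linarith : 0 ≤ E)
    simp only [L, Nat.cast_add, Nat.cast_one]
    linarith
  let m : ℕ := ⌊y / 8 - 1⌋₊
  have hm1 : (m : ℝ) ≤ y / 8 - 1 := Nat.floor_le (by linarith)
  have hm2 : y / 16 ≤ m := by
    have : y / 8 - 1 < m + 1 := Nat.lt_floor_add_one _
    linarith
  have hmL : 4 * (m * L) + 4 ≤ n := by
    have h1 : (m : ℝ) * L ≤ (y / 8 - 1) * (2 * E) := by
      gcongr
      linarith
    have h2 : (4 * (m * L) + 4 : ℝ) ≤ n := by nlinarith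
    exact_mod_cast h2
  have key := hsol.mul_log_le (m := m) (L := L) (g := n / 2 - m * L) ι.injective hab
    (by omega : 0 < q) (Nat.succ_pos _) hEL (Nat.sub_add_cancel (by omega)) (by omega)
  -- both error terms together are at most half of `m * log q`
  have hm0 : (0 : ℝ) ≤ m := Nat.cast_nonneg m
  have hl2 : 0 < Real.log 2 := Real.log_pos (by norm_num)
  have hlq : Real.log 2 ≤ Real.log q := Real.log_le_log (by norm_num) hq2R
  have hl4q : Real.log (4 * q) ≤ 3 * Real.log q := by
    rw [Real.log_mul (by norm_num) (by linarith), show (4 : ℝ) = 2 ^ 2 by norm_num, Real.log_pow]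
    push_cast
    linarith
  have hqn : (q : ℝ) / n ≤ 1 / 100 := by
    rw [div_le_div_iff₀ (by linarith) (by norm_num)]
    have h1 : (q : ℝ) * 100 ≤ √n * √n := by
      gcongr
      · exact hqs.trans (Real.sqrt_le_sqrt hyn)
      · exact Real.le_sqrt_of_sq_le (by linarith)
    rw [Real.mul_self_sqrt (by linarith)] at h1
    linarith
  have hl54 : Real.log (5 / 4) ≤ 1 / 3 * Real.log 2 := by
    have h : Real.log ((5 / 4) ^ 3) ≤ Real.log 2 := Real.log_le_log (by norm_num) (by norm_num)
    rw [Real.log_pow] at h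
    push_cast at h
    linarith
  have hl4q0 : 0 ≤ Real.log (4 * q) := Real.log_nonneg (by linarith)
  have t1 : (m : ℝ) * Real.log (5 / 4) ≤ m * (1 / 3 * Real.log q) := by
    gcongr
    linarith
  have t2 : (m : ℝ) * q / n * Real.log (4 * q) ≤ m * (1 / 100 * (3 * Real.log q)) := by
    rw [mul_div_assoc, mul_assoc]
    gcongr
  have t3 : y / 16 * Real.log q ≤ m * Real.log q := by gcongr
  have t4 : Real.log (min (Fintype.card A) y) ≤ 4 * Real.log q := by
    have h := Real.log_le_log (lt_min (by positivity) (by linarith)) hqz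
    rw [Real.log_pow] at h
    exact_mod_cast h
  have t5 : y * Real.log (min (Fintype.card A) y) ≤ y * (4 * Real.log q) := by gcongr
  have t6 : 0 ≤ (m : ℝ) * Real.log q := by positivity
  linarith

theorem mainTheorem1 :
    ∃ c : ℝ, 0 < c ∧ ∃ N : ℕ, ∀ n : ℕ, N ≤ n →
      ∀ (A : Type*) [Fintype A] (E : ℝ), 1 ≤ E → E ≤ 0.49 * (n : ℝ) →
      ∀ (s : ℕ) (Ω : Type*) [MeasurableSpace Ω] (P : MeasureTheory.Measure Ω)
        [MeasureTheory.IsProbabilityMeasure P] (alg : Ω → StreamingAlgorithm A s),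
        SolvesLongestPalindrome P alg n E →
          c * ((n : ℝ) / E * Real.logb 2 (min (Fintype.card A : ℝ) ((n : ℝ) / E))) ≤ (s : ℝ) := by
  refine ⟨1 / 1000, by norm_num, 10000, ?_⟩
  intro n hn A _ E hE hEn s Ω _ P _ alg hsol
  have hnR : (10000 : ℝ) ≤ n := by exact_mod_cast hn
  have hy0 : 1 ≤ (n : ℝ) / E := by
    rw [one_le_div (by linarith)]
    linarith
  have hl2 : 0 < Real.log 2 := Real.log_pos (by norm_num)
  rcases le_or_gt (Fintype.card A) 1 with hA | hA
  · -- the logarithm vanishes, in Lean also for the empty alphabet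
    have h : Real.logb 2 (min (Fintype.card A : ℝ) ((n : ℝ) / E)) = 0 := by
      interval_cases hc : Fintype.card A
      · rw [Nat.cast_zero, min_eq_left (by linarith), Real.logb_zero]
      · rw [Nat.cast_one, min_eq_left hy0, Real.logb_one]
    simp [h]
  obtain ⟨a, b, hab⟩ := Fintype.one_lt_card_iff.1 hA
  have hAR : (1 : ℝ) ≤ Fintype.card A := by exact_mod_cast hA.le
  rcases le_or_gt 100 ((n : ℝ) / E) with hy | hy
  · have h := hsol.mul_log_min_le hab hn hE hy
    rw [Real.logb, ← mul_div_assoc, ← mul_div_assoc, div_le_iff₀ hl2]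
    nlinarith
  · -- the bound is less than one bit
    have hpos : 0 < s := by
      refine hsol.memory_pos hab (by omega) (hEn.trans_lt ?_)
      have h : n ≤ 2 * (n / 2) + 1 := by omega
      have h' : (n : ℝ) ≤ 2 * (n / 2 : ℕ) + 1 := by exact_mod_cast h
      linarith
    have hs1 : (1 : ℝ) ≤ s := by exact_mod_cast hpos
    have hlog : Real.logb 2 (min (Fintype.card A : ℝ) ((n : ℝ) / E)) ≤ 7 := by
      rw [Real.logb_le_iff_le_rpow (by norm_num) (lt_min (by linarith) (by linarith))]
      refine (min_le_right _ _).trans ?_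
      norm_num
      linarith
    have hmul : (n : ℝ) / E * Real.logb 2 (min (Fintype.card A : ℝ) ((n : ℝ) / E)) ≤ 100 * 7 :=
      mul_le_mul hy.le hlog (Real.logb_nonneg (by norm_num) (le_min hAR hy0)) (by norm_num)
    linarith
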